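/- **Language.** Let $\mathsf{Prop},\mathsf{NOM},\mathsf{CNOM}$ be sets of proposition variables $p$, nominals $\mathbf j,\mathbf h,\mathbf k$ and conominals $\mathbf m$. Formulas: $A::=p\mid\top\mid\bot\mid A\wedge A\mid A\vee A\mid\Box A\mid\Diamond A$. Terms: $\mathbf T::=\mathbf j\mid\Diamond\mathbf j\mid\blacklozenge\mathbf j\mid\mathbf m\mid\Box\mathbf m\mid\blacksquare\mathbf m$. Structures are the inequalities $\mathbf j\le A$, $A\le\mathbf m$, $\mathbf j\le\mathbf T$ ($\mathbf j$ not in $\mathbf T$) and $\mathbf T\le\mathbf m$ ($\mathbf m$ not in $\mathbf T$). A sequent $\Gamma\vdash\Delta$ is a pair of finite multisets of structures. **Calculus.** For $\Sigma\subseteq\{(T),(4),(B),(D),(C)\}$, where $(T)\ \Box p\vdash p$, $(4)\ \Diamond\Diamond p\vdash\Diamond p$, $(B)\ p\vdash\Box\Diamond p$, $(D)\ \Box p\vdash\Diamond p$, $(C)\ \Diamond\Box p\vdash\Box\Diamond p$, the calculus $\mathbf{A.L}\Sigma$ has the following rules (premises / conclusion; all premises and conclusions are sequents as above): * Initial: $\mathbf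 j\le p\vdash\mathbf j\le p$; $p\le\mathbf m\vdash p\le\mathbf m$; $\bot\le\mathbf m\vdash\bot\le\mathbf m$; $\mathbf j\le\top\vdash\mathbf j\le\top$; $\mathbf j\le\bot\vdash\mathbf j\le A$; $\mathbf j\le A\vdash\mathbf j\le\top$ (with $A$ a variable, a conjunction or a $\Box$-formula); $B\le\mathbf m\vdash\bot\le\mathbf m$; $\top\le\mathbf m\vdash B\le\mathbf m$ (with $B$ a variable, a disjunction or a $\Diamond$-formula). * Cut, for $a$ of the form $\mathbf j\le A$ or $B\le\mathbf m$: $\Gamma\vdash a,\Delta$ and $\Gamma',a\vdash\Delta'$ / $\Gamma,\Gamma'\vdash\Delta,\Delta'$. * Switch rules: $\Gamma,\mathbf j\le A\vdash\mathbf j\le\mathbf m,\Delta$ / $\Gamma\vdash A\le\mathbf m,\Delta$ ($\mathbf j$ not in the conclusion); $\Gamma,A\le\mathbf m\vdash\mathbf j\le\mathbf m,\Delta$ / $\Gamma\vdash\mathbf j\le A,\Delta$ ($\mathbf m$ not in the conclusion); and, for $X,Y$ each a formula or a term, with $\mathbf j,\mathbf m$ not in $\Gamma,\Delta$: $\Gamma,\mathbf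 j\le X\vdash\mathbf j\le Y,\Delta$ / $\Gamma,Y\le\mathbf m\vdash X\le\mathbf m,\Delta$ and $\Gamma,X\le\mathbf m\vdash Y\le\mathbf m,\Delta$ / $\Gamma,\mathbf j\le Y\vdash\mathbf j\le X,\Delta$. * Adjunction, in both directions: $\Gamma\vdash\Diamond\mathbf j\le\mathbf m,\Delta$ / $\Gamma\vdash\mathbf j\le\blacksquare\mathbf m,\Delta$; $\Gamma\vdash\mathbf j\le\Box\mathbf m,\Delta$ / $\Gamma\vdash\blacklozenge\mathbf j\le\mathbf m,\Delta$. * Constants: $\Gamma\vdash\top\le\mathbf m,\Delta$ / $\Gamma,\mathbf j\le\top\vdash\mathbf j\le\Box\mathbf m,\Delta$; $\Gamma\vdash\mathbf j\le\bot,\Delta$ / $\Gamma,\bot\le\mathbf m\vdash\Diamond\mathbf j\le\mathbf m,\Delta$. * Propositional ($i=1,2$): $\Gamma,\mathbf j\le A_i\vdash\Delta$ / $\Gamma,\mathbf j\le A_1\wedge A_2\vdash\Delta$; $\Gamma\vdash\mathbf j\le A,\Delta$ and $\Gamma\vdash\mathbf j\le B,\Delta$ / $\Gamma\vdash\mathbf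 j\le A\wedge B,\Delta$; $\Gamma\vdash A\le\mathbf m,\Delta$ and $\Gamma\vdash B\le\mathbf m,\Delta$ / $\Gamma\vdash A\vee B\le\mathbf m,\Delta$; $\Gamma,A_i\le\mathbf m\vdash\Delta$ / $\Gamma,A_1\vee A_2\le\mathbf m\vdash\Delta$. * Modal: $\Gamma\vdash A\le\mathbf m,\Delta$ / $\Gamma,\mathbf j\le\Box A\vdash\mathbf j\le\Box\mathbf m,\Delta$; $\Gamma,A\le\mathbf m\vdash\mathbf j\le\Box\mathbf m,\Delta$ / $\Gamma\vdash\mathbf j\le\Box A,\Delta$ ($\mathbf m$ not in the conclusion); $\Gamma,\mathbf j\le A\vdash\Diamond\mathbf j\le\mathbf m,\Delta$ / $\Gamma\vdash\Diamond A\le\mathbf m,\Delta$ ($\mathbf j$ not in the conclusion); $\Gamma\vdash\mathbf j\le A,\Delta$ / $\Gamma,\Diamond A\le\mathbf m\vdash\Diamond\mathbf j\le\mathbf m,\Delta$. * For each principle in $\Sigma$ its rule: (4) $\Gamma\vdash\Diamond\mathbf j\le\mathbf m,\Delta$ / $\Gamma,\mathbf h\le\Diamond\mathbf j\vdash\Diamond\mathbf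 h\le\mathbf m,\Delta$; (T) $\Gamma\vdash\mathbf j\le\Box\mathbf m,\Delta$ / $\Gamma\vdash\mathbf j\le\mathbf m,\Delta$; (B) $\Gamma\vdash\Diamond\mathbf j\le\mathbf m,\Delta$ / $\Gamma\vdash\mathbf j\le\Box\mathbf m,\Delta$; (D) $\Gamma,\mathbf k\le\blacklozenge\mathbf j\vdash\Diamond\mathbf k\le\mathbf m,\Delta$ / $\Gamma\vdash\mathbf j\le\mathbf m,\Delta$; (C) $\Gamma,\mathbf k\le\blacklozenge\mathbf j\vdash\Diamond\mathbf k\le\mathbf m,\Delta$ / $\Gamma,\mathbf h\le\Diamond\mathbf j\vdash\blacklozenge\mathbf h\le\mathbf m,\Delta$; in (D) and (C), $\mathbf k$ does not occur in $\Gamma,\Delta$. (Any further restriction of cut and logical rules to labelled formulas in display, or to cut formulas with a particular origin in the derivation, only removes instances; soundness is claimed for all instances above.) **Semantics.** An $\mathcal L$-algebra $\mathbb A=(L,\Diamond,\Box)$ is a bounded lattice $L$ with $\Diamond$ preserving finite joins (including $\bot$) and $\Box$ preserving finite meets (including $\top$). Its canonical extension is $\mathbb A^\delta=(L^\delta,\Diamond^\sigma,\Box^\pi)$: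 $L^\delta$ is a complete lattice containing $L$ as a dense and compact bounded sublattice; with $K$ and $O$ the sets of meets, resp. joins, of subsets of $L$, $\Diamond^\sigma k=\bigwedge\{\Diamond a\mid a\in L,k\le a\}$ for $k\in K$ and $\Diamond^\sigma u=\bigvee\{\Diamond^\sigma k\mid k\in K,k\le u\}$, while $\Box^\pi o=\bigvee\{\Box a\mid a\in L,a\le o\}$ for $o\in O$ and $\Box^\pi u=\bigwedge\{\Box^\pi o\mid o\in O,u\le o\}$. The connective $\blacksquare$ is interpreted by the right adjoint $v\mapsto\bigvee\{u\mid\Diamond^\sigma u\le v\}$ of $\Diamond^\sigma$, and $\blacklozenge$ by the left adjoint $u\mapsto\bigwedge\{v\mid u\le\Box^\pi v\}$ of $\Box^\pi$. Fix a completely join-generating set $\mathcal J\subseteq L^\delta$ and a completely meet-generating set $\mathcal M\subseteq L^\delta$. Assignments send proposition variables to elements of $L^\delta$, nominals to elements of $\mathcal J$ and conominals to elements of $\mathcal M$. A sequent $\Gamma\vdash\Delta$ is valid if every assignment satisfying all inequalities in $\Gamma$ satisfies some inequality in $\Delta$. **Soundness.** For every $\Sigma\subseteq\{(T),(4),(B),(D),(C)\}$,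 every rule of $\mathbf{A.L}\Sigma$ is sound on $\mathsf K^\delta(\Sigma)=\{\mathbb A^\delta\mid\mathbb A\models\Sigma\}$: for every $\mathcal L$-algebra $\mathbb A$ that validates the principles in $\Sigma$, all $\mathcal J,\mathcal M$ as above and every instance of a rule of $\mathbf{A.L}\Sigma$, if the premises are valid in $\mathbb A^\delta$ then so is the conclusion. -/

import Mathlib

namespace AL

/-! ## Formulas, terms, labelled sequents -/

/-- Formulas of the lattice-based modal language over the atomic propositions `P`. -/
inductive Fml (P : Type*) where
  | var (p : P)
  | top
  | bot
  | and (A B : Fml P)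
  | or (A B : Fml P)
  | box (A : Fml P)
  | dia (A : Fml P)

/-- Terms over the nominals `N` and the conominals `M`. The first three constructors are the
nominal terms `j`, `◇j`, `◆j`; the last three are the conominal terms `m`, `□m`, `■m`. -/
inductive Tm (N M : Type*) where
  | nom (j : N)
  | dia (j : N)
  | bdia (j : N)
  | conom (m : M)
  | box (m : M)
  | bbox (m : M)

/-- One side of an inequality: a formula or a term. -/
inductive Expr (P N M : Type*) where
  | fml (A : Fml P)
  | tm (t : Tm N M)

/-- A raw inequality `lhs ≤ rhs`. -/
structure Ineq (P N M : Type*) where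
  lhs : Expr P N M
  rhs : Expr P N M

variable {P N M : Type*}

/-- The nominal `j` occurs in the term. -/
def Tm.HasNom (j : N) : Tm N M → Prop
  | nom i => i = j
  | dia i => i = j
  | bdia i => i = j
  | _ => False

/-- The conominal `m` occurs in the term. -/
def Tm.HasConom (m : M) : Tm N M → Prop
  | conom n => n = m
  | box n => n = m
  | bbox n => n = m
  | _ => False

def Expr.HasNom (j : N) : Expr P N M → Prop
  | fml _ => False
  | tm t => t.HasNom j

def Expr.HasConom (m : M) : Expr P N M → Prop
  | fml _ => False
  | tm t => t.HasConom m

def Ineq.HasNom (j : N) (s : Ineq P N M) : Prop := s.lhs.HasNom j ∨ s.rhs.HasNom j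

def Ineq.HasConom (m : M) (s : Ineq P N M) : Prop := s.lhs.HasConom m ∨ s.rhs.HasConom m

/-- The labelled formula `j ≤ A`. -/
def nomFml (j : N) (A : Fml P) : Ineq P N M := ⟨.tm (.nom j), .fml A⟩

/-- The labelled formula `A ≤ m`. -/
def fmlConom (A : Fml P) (m : M) : Ineq P N M := ⟨.fml A, .tm (.conom m)⟩

/-- The inequality `j ≤ T`. -/
def nomTm (j : N) (T : Tm N M) : Ineq P N M := ⟨.tm (.nom j), .tm T⟩

/-- The inequality `T ≤ m`. Note that `nomTm j (.conom m)` and `tmConom (.nom j) m` are the same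
object `j ≤ m`. -/
def tmConom (T : Tm N M) (m : M) : Ineq P N M := ⟨.tm T, .tm (.conom m)⟩

/-- The structures: labelled formulas `j ≤ A` and `A ≤ m`, and pure structures `j ≤ T` and `T ≤ m`,
where `j` (resp. `m`) does not occur in `T`. -/
inductive IsStructure : Ineq P N M → Prop
  | nomFml (j : N) (A : Fml P) : IsStructure (nomFml j A)
  | fmlConom (A : Fml P) (m : M) : IsStructure (fmlConom A m)
  | nomTm (j : N) (T : Tm N M) (h : ¬ T.HasNom j) : IsStructure (nomTm j T)
  | tmConom (T : Tm N M) (m : M) (h : ¬ T.HasConom m) : IsStructure (tmConom T m)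

/-- A raw sequent `ant ⊢ suc`; both sides are finite multisets of inequalities. -/
structure Sequent (P N M : Type*) where
  ant : Multiset (Ineq P N M)
  suc : Multiset (Ineq P N M)

/-- The sequents of the calculus: all members are structures. -/
def Sequent.WellFormed (s : Sequent P N M) : Prop :=
  (∀ a ∈ s.ant, IsStructure a) ∧ (∀ a ∈ s.suc, IsStructure a)

/-- The nominal `j` does not occur in `Γ`. -/
def FreshNom (j : N) (Γ : Multiset (Ineq P N M)) : Prop := ∀ a ∈ Γ, ¬ a.HasNom j

/-- The conominal `m` does not occur in `Γ`. -/
def FreshConom (m : M) (Γ : Multiset (Ineq P N M)) : Prop := ∀ a ∈ Γ, ¬ a.HasConom m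

/-! ## The modal principles -/

/-- Names of the five modal principles. -/
inductive Principle where
  | T
  | four
  | B
  | D
  | C

/-- Left-hand side of a principle, instantiated with the formula `A`. -/
def Principle.lhs (A : Fml P) : Principle → Fml P
  | T => .box A
  | four => .dia (.dia A)
  | B => A
  | D => .box A
  | C => .dia (.box A)

/-- Right-hand side of a principle, instantiated with the formula `A`. -/
def Principle.rhs (A : Fml P) : Principle → Fml P
  | T => A
  | four => .dia A
  | B => .box (.dia A)
  | D => .dia A
  | C => .box (.dia A)

/-! ## The rules of the calculus -/

/-- The formulas allowed on the right of the initial sequent `j ≤ ⊥ ⊢ j ≤ A`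
and on the left of `j ≤ A ⊢ j ≤ ⊤`. -/
inductive NomShape : Fml P → Prop
  | var (p : P) : NomShape (.var p)
  | and (A B : Fml P) : NomShape (.and A B)
  | box (A : Fml P) : NomShape (.box A)

/-- The formulas `B` allowed in the initial sequents `B ≤ m ⊢ ⊥ ≤ m` and `⊤ ≤ m ⊢ B ≤ m`. -/
inductive ConomShape : Fml P → Prop
  | var (p : P) : ConomShape (.var p)
  | or (A B : Fml P) : ConomShape (.or A B)
  | dia (A : Fml P) : ConomShape (.dia A)

/-- `RuleScheme Sig ps c`: the conclusion `c` follows from the list of premises `ps` by one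
application of one of the rule schemes of the calculus for the set `Sig` of modal principles.
The restrictions on cut rules and logical rules that certain labelled formulas be in display, and
that cut formulas be of a certain origin in the surrounding derivation, are not imposed, so that
all the instances that satisfy them, and others, are included. -/
inductive RuleScheme (Sig : Set Principle) : List (Sequent P N M) → Sequent P N M → Prop
  -- initial rules
  | id_nom (j : N) (p : P) :
      RuleScheme Sig [] ⟨{nomFml j (.var p)}, {nomFml j (.var p)}⟩
  | id_conom (p : P) (m : M) :
      RuleScheme Sig [] ⟨{fmlConom (.var p) m}, {fmlConom (.var p) m}⟩
  | id_bot (m : M) :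
      RuleScheme Sig [] ⟨{fmlConom .bot m}, {fmlConom .bot m}⟩
  | id_top (j : N) :
      RuleScheme Sig [] ⟨{nomFml j .top}, {nomFml j .top}⟩
  | bot_nom (j : N) (A : Fml P) (hA : NomShape A) :
      RuleScheme Sig [] ⟨{nomFml j .bot}, {nomFml j A}⟩
  | bot_conom (B : Fml P) (m : M) (hB : ConomShape B) :
      RuleScheme Sig [] ⟨{fmlConom B m}, {fmlConom .bot m}⟩
  | top_conom (B : Fml P) (m : M) (hB : ConomShape B) :
      RuleScheme Sig [] ⟨{fmlConom .top m}, {fmlConom B m}⟩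
  | top_nom (j : N) (A : Fml P) (hA : NomShape A) :
      RuleScheme Sig [] ⟨{nomFml j A}, {nomFml j .top}⟩
  -- cut rules
  | cut_nom (Γ Γ' Δ Δ' : Multiset (Ineq P N M)) (j : N) (A : Fml P) :
      RuleScheme Sig [⟨Γ, nomFml j A ::ₘ Δ⟩, ⟨nomFml j A ::ₘ Γ', Δ'⟩] ⟨Γ + Γ', Δ + Δ'⟩
  | cut_conom (Γ Γ' Δ Δ' : Multiset (Ineq P N M)) (B : Fml P) (m : M) :
      RuleScheme Sig [⟨Γ, fmlConom B m ::ₘ Δ⟩, ⟨fmlConom B m ::ₘ Γ', Δ'⟩] ⟨Γ + Γ', Δ + Δ'⟩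
  -- switch rules
  | sw_m (Γ Δ : Multiset (Ineq P N M)) (j : N) (m : M) (A : Fml P)
      (hΓ : FreshNom j Γ) (hΔ : FreshNom j Δ) :
      RuleScheme Sig [⟨nomFml j A ::ₘ Γ, nomTm j (.conom m) ::ₘ Δ⟩] ⟨Γ, fmlConom A m ::ₘ Δ⟩
  | sw_j (Γ Δ : Multiset (Ineq P N M)) (j : N) (m : M) (A : Fml P)
      (hΓ : FreshConom m Γ) (hΔ : FreshConom m Δ) :
      RuleScheme Sig [⟨fmlConom A m ::ₘ Γ, nomTm j (.conom m) ::ₘ Δ⟩] ⟨Γ, nomFml j A ::ₘ Δ⟩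
  | sw_mm (Γ Δ : Multiset (Ineq P N M)) (j : N) (m : M) (A B : Fml P)
      (hjΓ : FreshNom j Γ) (hjΔ : FreshNom j Δ) (hmΓ : FreshConom m Γ) (hmΔ : FreshConom m Δ) :
      RuleScheme Sig [⟨nomFml j A ::ₘ Γ, nomFml j B ::ₘ Δ⟩]
        ⟨fmlConom B m ::ₘ Γ, fmlConom A m ::ₘ Δ⟩
  | sw_jj (Γ Δ : Multiset (Ineq P N M)) (j : N) (m : M) (A B : Fml P)
      (hjΓ : FreshNom j Γ) (hjΔ : FreshNom j Δ) (hmΓ : FreshConom m Γ) (hmΔ : FreshConom m Δ) :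
      RuleScheme Sig [⟨fmlConom A m ::ₘ Γ, fmlConom B m ::ₘ Δ⟩]
        ⟨nomFml j B ::ₘ Γ, nomFml j A ::ₘ Δ⟩
  | sw_mT (Γ Δ : Multiset (Ineq P N M)) (j : N) (m : M) (A : Fml P) (T : Tm N M)
      (hjΓ : FreshNom j Γ) (hjΔ : FreshNom j Δ) (hmΓ : FreshConom m Γ) (hmΔ : FreshConom m Δ) :
      RuleScheme Sig [⟨nomTm j T ::ₘ Γ, nomFml j A ::ₘ Δ⟩]
        ⟨fmlConom A m ::ₘ Γ, tmConom T m ::ₘ Δ⟩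
  | sw_jT (Γ Δ : Multiset (Ineq P N M)) (j : N) (m : M) (A : Fml P) (T : Tm N M)
      (hjΓ : FreshNom j Γ) (hjΔ : FreshNom j Δ) (hmΓ : FreshConom m Γ) (hmΔ : FreshConom m Δ) :
      RuleScheme Sig [⟨tmConom T m ::ₘ Γ, fmlConom A m ::ₘ Δ⟩]
        ⟨nomFml j A ::ₘ Γ, nomTm j T ::ₘ Δ⟩
  | sw_Tm (Γ Δ : Multiset (Ineq P N M)) (j : N) (m : M) (A : Fml P) (T : Tm N M)
      (hjΓ : FreshNom j Γ) (hjΔ : FreshNom j Δ) (hmΓ : FreshConom m Γ) (hmΔ : FreshConom m Δ) :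
      RuleScheme Sig [⟨nomFml j A ::ₘ Γ, nomTm j T ::ₘ Δ⟩]
        ⟨tmConom T m ::ₘ Γ, fmlConom A m ::ₘ Δ⟩
  | sw_Tj (Γ Δ : Multiset (Ineq P N M)) (j : N) (m : M) (A : Fml P) (T : Tm N M)
      (hjΓ : FreshNom j Γ) (hjΔ : FreshNom j Δ) (hmΓ : FreshConom m Γ) (hmΔ : FreshConom m Δ) :
      RuleScheme Sig [⟨fmlConom A m ::ₘ Γ, tmConom T m ::ₘ Δ⟩]
        ⟨nomTm j T ::ₘ Γ, nomFml j A ::ₘ Δ⟩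
  | sw_TTm (Γ Δ : Multiset (Ineq P N M)) (j : N) (m : M) (T T' : Tm N M)
      (hjΓ : FreshNom j Γ) (hjΔ : FreshNom j Δ) (hmΓ : FreshConom m Γ) (hmΔ : FreshConom m Δ) :
      RuleScheme Sig [⟨nomTm j T' ::ₘ Γ, nomTm j T ::ₘ Δ⟩]
        ⟨tmConom T m ::ₘ Γ, tmConom T' m ::ₘ Δ⟩
  | sw_jTT (Γ Δ : Multiset (Ineq P N M)) (j : N) (m : M) (T T' : Tm N M)
      (hjΓ : FreshNom j Γ) (hjΔ : FreshNom j Δ) (hmΓ : FreshConom m Γ) (hmΔ : FreshConom m Δ) :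
      RuleScheme Sig [⟨tmConom T' m ::ₘ Γ, tmConom T m ::ₘ Δ⟩]
        ⟨nomTm j T ::ₘ Γ, nomTm j T' ::ₘ Δ⟩
  -- adjunction rules
  | adj_dia (Γ Δ : Multiset (Ineq P N M)) (j : N) (m : M) :
      RuleScheme Sig [⟨Γ, tmConom (.dia j) m ::ₘ Δ⟩] ⟨Γ, nomTm j (.bbox m) ::ₘ Δ⟩
  | adj_dia_inv (Γ Δ : Multiset (Ineq P N M)) (j : N) (m : M) :
      RuleScheme Sig [⟨Γ, nomTm j (.bbox m) ::ₘ Δ⟩] ⟨Γ, tmConom (.dia j) m ::ₘ Δ⟩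
  | adj_box (Γ Δ : Multiset (Ineq P N M)) (j : N) (m : M) :
      RuleScheme Sig [⟨Γ, nomTm j (.box m) ::ₘ Δ⟩] ⟨Γ, tmConom (.bdia j) m ::ₘ Δ⟩
  | adj_box_inv (Γ Δ : Multiset (Ineq P N M)) (j : N) (m : M) :
      RuleScheme Sig [⟨Γ, tmConom (.bdia j) m ::ₘ Δ⟩] ⟨Γ, nomTm j (.box m) ::ₘ Δ⟩
  -- structural rules for the constants
  | top_box (Γ Δ : Multiset (Ineq P N M)) (j : N) (m : M) :
      RuleScheme Sig [⟨Γ, fmlConom .top m ::ₘ Δ⟩]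
        ⟨nomFml j .top ::ₘ Γ, nomTm j (.box m) ::ₘ Δ⟩
  | bot_dia (Γ Δ : Multiset (Ineq P N M)) (j : N) (m : M) :
      RuleScheme Sig [⟨Γ, nomFml j .bot ::ₘ Δ⟩]
        ⟨fmlConom .bot m ::ₘ Γ, tmConom (.dia j) m ::ₘ Δ⟩
  -- logical rules for the propositional connectives
  | and_P₁ (Γ Δ : Multiset (Ineq P N M)) (j : N) (A B : Fml P) :
      RuleScheme Sig [⟨nomFml j A ::ₘ Γ, Δ⟩] ⟨nomFml j (.and A B) ::ₘ Γ, Δ⟩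
  | and_P₂ (Γ Δ : Multiset (Ineq P N M)) (j : N) (A B : Fml P) :
      RuleScheme Sig [⟨nomFml j B ::ₘ Γ, Δ⟩] ⟨nomFml j (.and A B) ::ₘ Γ, Δ⟩
  | and_S (Γ Δ : Multiset (Ineq P N M)) (j : N) (A B : Fml P) :
      RuleScheme Sig [⟨Γ, nomFml j A ::ₘ Δ⟩, ⟨Γ, nomFml j B ::ₘ Δ⟩]
        ⟨Γ, nomFml j (.and A B) ::ₘ Δ⟩
  | or_P (Γ Δ : Multiset (Ineq P N M)) (m : M) (A B : Fml P) :
      RuleScheme Sig [⟨Γ, fmlConom A m ::ₘ Δ⟩, ⟨Γ, fmlConom B m ::ₘ Δ⟩]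
        ⟨Γ, fmlConom (.or A B) m ::ₘ Δ⟩
  | or_S₁ (Γ Δ : Multiset (Ineq P N M)) (m : M) (A B : Fml P) :
      RuleScheme Sig [⟨fmlConom A m ::ₘ Γ, Δ⟩] ⟨fmlConom (.or A B) m ::ₘ Γ, Δ⟩
  | or_S₂ (Γ Δ : Multiset (Ineq P N M)) (m : M) (A B : Fml P) :
      RuleScheme Sig [⟨fmlConom B m ::ₘ Γ, Δ⟩] ⟨fmlConom (.or A B) m ::ₘ Γ, Δ⟩
  -- logical rules for the modalities
  | box_P (Γ Δ : Multiset (Ineq P N M)) (j : N) (m : M) (A : Fml P) :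
      RuleScheme Sig [⟨Γ, fmlConom A m ::ₘ Δ⟩]
        ⟨nomFml j (.box A) ::ₘ Γ, nomTm j (.box m) ::ₘ Δ⟩
  | box_S (Γ Δ : Multiset (Ineq P N M)) (j : N) (m : M) (A : Fml P)
      (hΓ : FreshConom m Γ) (hΔ : FreshConom m Δ) :
      RuleScheme Sig [⟨fmlConom A m ::ₘ Γ, nomTm j (.box m) ::ₘ Δ⟩]
        ⟨Γ, nomFml j (.box A) ::ₘ Δ⟩
  | dia_P (Γ Δ : Multiset (Ineq P N M)) (j : N) (m : M) (A : Fml P)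
      (hΓ : FreshNom j Γ) (hΔ : FreshNom j Δ) :
      RuleScheme Sig [⟨nomFml j A ::ₘ Γ, tmConom (.dia j) m ::ₘ Δ⟩]
        ⟨Γ, fmlConom (.dia A) m ::ₘ Δ⟩
  | dia_S (Γ Δ : Multiset (Ineq P N M)) (j : N) (m : M) (A : Fml P) :
      RuleScheme Sig [⟨Γ, nomFml j A ::ₘ Δ⟩]
        ⟨fmlConom (.dia A) m ::ₘ Γ, tmConom (.dia j) m ::ₘ Δ⟩
  -- additional rules for the modal principles in `Sig`
  | rule_four (hSig : Principle.four ∈ Sig)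
      (Γ Δ : Multiset (Ineq P N M)) (j h : N) (m : M) :
      RuleScheme Sig [⟨Γ, tmConom (.dia j) m ::ₘ Δ⟩]
        ⟨nomTm h (.dia j) ::ₘ Γ, tmConom (.dia h) m ::ₘ Δ⟩
  | rule_T (hSig : Principle.T ∈ Sig) (Γ Δ : Multiset (Ineq P N M)) (j : N) (m : M) :
      RuleScheme Sig [⟨Γ, nomTm j (.box m) ::ₘ Δ⟩] ⟨Γ, nomTm j (.conom m) ::ₘ Δ⟩
  | rule_B (hSig : Principle.B ∈ Sig) (Γ Δ : Multiset (Ineq P N M)) (j : N) (m : M) :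
      RuleScheme Sig [⟨Γ, tmConom (.dia j) m ::ₘ Δ⟩] ⟨Γ, nomTm j (.box m) ::ₘ Δ⟩
  | rule_D (hSig : Principle.D ∈ Sig) (Γ Δ : Multiset (Ineq P N M)) (j k : N) (m : M)
      (hΓ : FreshNom k Γ) (hΔ : FreshNom k Δ) :
      RuleScheme Sig [⟨nomTm k (.bdia j) ::ₘ Γ, tmConom (.dia k) m ::ₘ Δ⟩]
        ⟨Γ, nomTm j (.conom m) ::ₘ Δ⟩
  | rule_C (hSig : Principle.C ∈ Sig) (Γ Δ : Multiset (Ineq P N M)) (j k h : N) (m : M)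
      (hΓ : FreshNom k Γ) (hΔ : FreshNom k Δ) :
      RuleScheme Sig [⟨nomTm k (.bdia j) ::ₘ Γ, tmConom (.dia k) m ::ₘ Δ⟩]
        ⟨nomTm h (.dia j) ::ₘ Γ, tmConom (.bdia h) m ::ₘ Δ⟩

/-- An inference of the calculus: an instance of a rule scheme in which premises and conclusion are
sequents of the calculus, i.e. consist of structures. -/
def Inference (Sig : Set Principle) (ps : List (Sequent P N M)) (c : Sequent P N M) : Prop :=
  RuleScheme Sig ps c ∧ (∀ s ∈ ps, s.WellFormed) ∧ c.WellFormed

/-! ## Algebras and canonical extensions -/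

/-- Normal modal operators on a bounded lattice `L`. -/
structure ModalOps (L : Type*) [Lattice L] [BoundedOrder L] where
  dia : L → L
  box : L → L
  dia_sup : ∀ x y, dia (x ⊔ y) = dia x ⊔ dia y
  dia_bot : dia ⊥ = ⊥
  box_inf : ∀ x y, box (x ⊓ y) = box x ⊓ box y
  box_top : box ⊤ = ⊤

/-- Value of a formula, where `◇` and `□` are interpreted by `d` and `b`. -/
def Fml.eval {L : Type*} [Lattice L] [BoundedOrder L] (d b : L → L) (v : P → L) : Fml P → L
  | var p => v p
  | top => ⊤
  | bot => ⊥
  | and A B => A.eval d b v ⊓ B.eval d b v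
  | or A B => A.eval d b v ⊔ B.eval d b v
  | box A => b (A.eval d b v)
  | dia A => d (A.eval d b v)

/-- The algebra validates the principle, read as an inequality in one proposition variable `p`:
it holds under all assignments of an element of the algebra to `p`. -/
def ModalOps.Validates {L : Type*} [Lattice L] [BoundedOrder L] (𝔸 : ModalOps L)
    (x : Principle) : Prop :=
  ∀ v : Unit → L,
    (x.lhs (Fml.var ())).eval 𝔸.dia 𝔸.box v ≤ (x.rhs (Fml.var ())).eval 𝔸.dia 𝔸.box v

section CanonicalExtension

variable {L C : Type*} [Lattice L] [BoundedOrder L] [CompleteLattice C]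

/-- Closed elements: meets of subsets of (the image of) `L`. -/
def IsClosedElt (e : BoundedLatticeHom L C) (k : C) : Prop := ∃ S : Set L, k = sInf (e '' S)

/-- Open elements: joins of subsets of (the image of) `L`. -/
def IsOpenElt (e : BoundedLatticeHom L C) (o : C) : Prop := ∃ S : Set L, o = sSup (e '' S)

/-- The complete lattice `C`, with the embedding `e`, is a canonical extension of `L`. -/
structure IsCanonicalExtension (e : BoundedLatticeHom L C) : Prop where
  injective : Function.Injective e
  dense_join : ∀ u : C, ∃ K : Set C, (∀ k ∈ K, IsClosedElt e k) ∧ u = sSup K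
  dense_meet : ∀ u : C, ∃ O : Set C, (∀ o ∈ O, IsOpenElt e o) ∧ u = sInf O
  compact : ∀ S T : Set L, sInf (e '' S) ≤ sSup (e '' T) →
    ∃ S' T' : Finset L, ↑S' ⊆ S ∧ ↑T' ⊆ T ∧ sInf (e '' (S' : Set L)) ≤ sSup (e '' (T' : Set L))

/-- The `σ`-extension of `f` on closed elements. -/
def sigmaClosed (e : BoundedLatticeHom L C) (f : L → L) (k : C) : C :=
  sInf {x | ∃ a : L, k ≤ e a ∧ x = e (f a)}

/-- The `σ`-extension of `f`. -/
def sigmaExt (e : BoundedLatticeHom L C) (f : L → L) (u : C) : C :=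
  sSup {x | ∃ k : C, IsClosedElt e k ∧ k ≤ u ∧ x = sigmaClosed e f k}

/-- The `π`-extension of `f` on open elements. -/
def piOpen (e : BoundedLatticeHom L C) (f : L → L) (o : C) : C :=
  sSup {x | ∃ a : L, e a ≤ o ∧ x = e (f a)}

/-- The `π`-extension of `f`. -/
def piExt (e : BoundedLatticeHom L C) (f : L → L) (u : C) : C :=
  sInf {x | ∃ o : C, IsOpenElt e o ∧ u ≤ o ∧ x = piOpen e f o}

/-- The right adjoint of a completely join-preserving map `d` (applied to `◇^σ`, it gives `■`). -/
def rightAdj (d : C → C) (v : C) : C := sSup {u | d u ≤ v}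

/-- The left adjoint of a completely meet-preserving map `b` (applied to `□^π`, it gives `◆`). -/
def leftAdj (b : C → C) (u : C) : C := sInf {v | u ≤ b v}

/-- `J` completely join-generates `C`. -/
def JoinGenerates (J : Set C) : Prop := ∀ u : C, ∃ S ⊆ J, u = sSup S

/-- `M` completely meet-generates `C`. -/
def MeetGenerates (M : Set C) : Prop := ∀ u : C, ∃ S ⊆ M, u = sInf S

end CanonicalExtension

/-! ## Validity of sequents -/

section Semantics

variable {C : Type*} [CompleteLattice C]

/-- An assignment: proposition variables range over `C`, nominals over `𝒥`, conominals over `ℳ`. -/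
structure Assignment (P N M : Type*) (𝒥 ℳ : Set C) where
  prop : P → C
  nom : N → 𝒥
  conom : M → ℳ

variable {𝒥 ℳ : Set C}

/-- Value of a term, where `d` and `b` interpret `◇` and `□`. -/
def Tm.eval (d b : C → C) (v : Assignment P N M 𝒥 ℳ) : Tm N M → C
  | nom j => v.nom j
  | dia j => d (v.nom j)
  | bdia j => leftAdj b (v.nom j)
  | conom m => v.conom m
  | box m => b (v.conom m)
  | bbox m => rightAdj d (v.conom m)

def Expr.eval (d b : C → C) (v : Assignment P N M 𝒥 ℳ) : Expr P N M → C
  | fml A => A.eval d b v.prop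
  | tm t => t.eval d b v

/-- The assignment satisfies the inequality. -/
def Ineq.Holds (d b : C → C) (v : Assignment P N M 𝒥 ℳ) (s : Ineq P N M) : Prop :=
  s.lhs.eval d b v ≤ s.rhs.eval d b v

/-- Every assignment that satisfies all inequalities in the antecedent satisfies some inequality in
the succedent; `d` and `b` interpret `◇` and `□`, and `𝒥` and `ℳ` are the ranges of the nominals and
of the conominals. -/
def Sequent.Valid (d b : C → C) (𝒥 ℳ : Set C) (s : Sequent P N M) : Prop :=
  ∀ v : Assignment P N M 𝒥 ℳ, (∀ a ∈ s.ant, a.Holds d b v) → ∃ a ∈ s.suc, a.Holds d b v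

/-- Validity in the canonical extension `(C, ◇^σ, □^π)` of the algebra `𝔸` on `L`. -/
def Sequent.ValidInExtension {L : Type*} [Lattice L] [BoundedOrder L] (𝔸 : ModalOps L)
    (e : BoundedLatticeHom L C) (𝒥 ℳ : Set C) (s : Sequent P N M) : Prop :=
  s.Valid (sigmaExt e 𝔸.dia) (piExt e 𝔸.box) 𝒥 ℳ

end Semantics

end AL

namespace AL

/-! Soundness splits into an algebraic and an order-theoretic half. On the order side, a rule is
checked by contraposition: an assignment refuting the conclusion yields one refuting a premise. A
fresh nominal or conominal may be reassigned without disturbing the context, so it acts as a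
quantifier over `𝒥` or `ℳ`; generation then turns the premise into an inequality between arbitrary
elements. Modal rules first move `◇` or `□` across by adjunction, and the rules for principles use
the corresponding inequalities for all elements (`Inference.sound`).

The algebraic half supplies those adjoints and inequalities for the canonical extension. Compactness
gives `IsCanonicalExtension.sigmaClosed_le_iff`, density extends it to all elements and yields the
right adjoint of `◇^σ`; order duality gives the left adjoint of `□^π`. Since `◆` keeps closed
elements closed (`leftAdj_piExt_eq`), each principle can be reduced to its instances in `L`
(`ModalOps.Validates.canonical`). -/

theorem monotone_of_map_sup {L : Type*} [Lattice L] {f : L → L}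
    (hf : ∀ x y, f (x ⊔ y) = f x ⊔ f y) : Monotone f :=
  fun x y h => by rw [← sup_eq_right.2 h, hf]; exact le_sup_left

/-! ### Adjoints of the extended operators, by density, compactness and duality -/

section CanonicalExtension

variable {L C : Type*} [Lattice L] [BoundedOrder L] [CompleteLattice C]
  {e : BoundedLatticeHom L C}

theorem sInf_image_finset (e : BoundedLatticeHom L C) (S : Finset L) :
    sInf (e '' (S : Set L)) = e (S.inf id) := by
  rw [map_finset_inf, Finset.inf_eq_iInf, sInf_image]
  rfl

theorem sSup_image_finset (e : BoundedLatticeHom L C) (S : Finset L) :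
    sSup (e '' (S : Set L)) = e (S.sup id) := by
  rw [map_finset_sup, Finset.sup_eq_iSup, sSup_image]
  rfl

theorem isClosedElt_map (e : BoundedLatticeHom L C) (a : L) : IsClosedElt e (e a) :=
  ⟨{a}, by simp⟩

theorem IsCanonicalExtension.le_iff_le (he : IsCanonicalExtension e) {a b : L} :
    e a ≤ e b ↔ a ≤ b := by
  rw [← inf_eq_left, ← map_inf, he.injective.eq_iff, inf_eq_left]

/-- Join-density in the form used throughout: closed elements below the left side suffice as tests.
The next lemma is its dual, with open elements above the right side. -/
theorem IsCanonicalExtension.le_of_closed (he : IsCanonicalExtension e) {u w : C}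
    (h : ∀ k, IsClosedElt e k → k ≤ u → k ≤ w) : u ≤ w := by
  obtain ⟨K, hK, rfl⟩ := he.dense_join u
  exact sSup_le fun k hk => h k (hK k hk) (le_sSup hk)

theorem IsCanonicalExtension.le_of_open (he : IsCanonicalExtension e) {u w : C}
    (h : ∀ o, IsOpenElt e o → w ≤ o → u ≤ o) : u ≤ w := by
  obtain ⟨O, hO, rfl⟩ := he.dense_meet w
  exact le_sInf fun o ho => h o (hO o ho) (sInf_le ho)

/-- Canonical extensions are self-dual. -/
theorem IsCanonicalExtension.dual (he : IsCanonicalExtension e) :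
    IsCanonicalExtension (BoundedLatticeHom.dual e) where
  injective := he.injective
  dense_join := he.dense_meet
  dense_meet := he.dense_join
  compact S T h := by
    obtain ⟨S', T', hS, hT, h'⟩ := he.compact T S h
    exact ⟨T', S', hT, hS, h'⟩

theorem map_finset_sup_of {f : L → L} (hf : ∀ x y, f (x ⊔ y) = f x ⊔ f y) (h0 : f ⊥ = ⊥)
    (S : Finset L) : f (S.sup id) = S.sup f := by
  classical
  induction S using Finset.induction_on with
  | empty => simpa using h0
  | insert a S _ ih => simp [hf, ih]

theorem sigmaClosed_mono (f : L → L) {k k' : C} (h : k ≤ k') :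
    sigmaClosed e f k ≤ sigmaClosed e f k' :=
  sInf_le_sInf fun _ ⟨a, ha, hx⟩ => ⟨a, h.trans ha, hx⟩

theorem sigmaExt_of_isClosedElt (f : L → L) {k : C} (hk : IsClosedElt e k) :
    sigmaExt e f k = sigmaClosed e f k := by
  apply le_antisymm
  · apply sSup_le
    rintro _ ⟨k', -, h, rfl⟩
    exact sigmaClosed_mono f h
  · exact le_sSup ⟨k, hk, le_rfl, rfl⟩

theorem IsCanonicalExtension.sigmaExt_map (he : IsCanonicalExtension e) {f : L → L}
    (hf : Monotone f) (a : L) : sigmaExt e f (e a) = e (f a) := by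
  rw [sigmaExt_of_isClosedElt f (isClosedElt_map e a)]
  apply le_antisymm
  · exact sInf_le ⟨a, le_rfl, rfl⟩
  · apply le_sInf
    rintro _ ⟨b, hb, rfl⟩
    exact he.le_iff_le.2 (hf (he.le_iff_le.1 hb))

/-- On closed elements, the `σ`-extension of an operator is below an open element exactly if the
closed element is below the join of the elements of `L` that the operator maps below the
open one. -/
theorem IsCanonicalExtension.sigmaClosed_le_iff (he : IsCanonicalExtension e) {f : L → L}
    (hf : ∀ x y, f (x ⊔ y) = f x ⊔ f y) (h0 : f ⊥ = ⊥) {k o : C}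
    (hk : IsClosedElt e k) (ho : IsOpenElt e o) :
    sigmaClosed e f k ≤ o ↔ k ≤ sSup (e '' {a | e (f a) ≤ o}) := by
  classical
  have hmono := monotone_of_map_sup hf
  constructor
  · intro h
    obtain ⟨T, rfl⟩ := ho
    -- Compactness leaves finitely many `f a` with `k ≤ e a`. The meet of these `a` is a single
    -- element of `L` above `k`, and monotonicity of `f` puts its image below `o`.
    have h' : sInf (e '' (f '' {a | k ≤ e a})) ≤ sSup (e '' T) := by
      refine le_trans (le_sInf ?_) h
      rintro _ ⟨a, ha, rfl⟩
      exact sInf_le ⟨f a, ⟨a, ha, rfl⟩, rfl⟩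
    obtain ⟨S', T', hS, hT, hle⟩ := he.compact _ _ h'
    obtain ⟨R, hR, rfl⟩ := Finset.subset_set_image_iff.1 hS
    rw [sInf_image_finset] at hle
    have hkR : k ≤ e (R.inf id) := by
      rw [← sInf_image_finset]
      apply le_sInf
      rintro _ ⟨a, ha, rfl⟩
      exact hR ha
    refine hkR.trans (le_sSup ⟨_, ?_, rfl⟩)
    refine le_trans (le_trans (he.le_iff_le.2 (Finset.le_inf ?_)) hle)
      (sSup_le_sSup (Set.image_mono hT))
    intro b hb
    obtain ⟨a, ha, rfl⟩ := Finset.mem_image.1 hb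
    exact hmono (Finset.inf_le (f := id) ha)
  · intro h
    obtain ⟨S, rfl⟩ := hk
    -- Finitely many elements that `f` sends below `o` already cover `k`. Their join is also sent
    -- below `o`, as `f` preserves finite joins; `h0` is the empty case.
    obtain ⟨S', T', hS, hT, hle⟩ := he.compact _ _ h
    rw [sSup_image_finset] at hle
    have hk' : sInf (e '' S) ≤ e (T'.sup id) := (sInf_le_sInf (Set.image_mono hS)).trans hle
    refine le_trans (sInf_le ⟨_, hk', rfl⟩) ?_
    rw [map_finset_sup_of hf h0, map_finset_sup]
    exact Finset.sup_le fun a ha => hT ha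

theorem IsCanonicalExtension.sigmaExt_le_iff (he : IsCanonicalExtension e) {f : L → L}
    (hf : ∀ x y, f (x ⊔ y) = f x ⊔ f y) (h0 : f ⊥ = ⊥) {u o : C} (ho : IsOpenElt e o) :
    sigmaExt e f u ≤ o ↔ u ≤ sSup (e '' {a | e (f a) ≤ o}) := by
  constructor
  · intro h
    refine he.le_of_closed fun k hk hku => ?_
    rw [← he.sigmaClosed_le_iff hf h0 hk ho]
    refine le_trans ?_ h
    exact le_sSup ⟨k, hk, hku, rfl⟩
  · intro h
    refine sSup_le ?_
    rintro _ ⟨k, hk, hku, rfl⟩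
    exact (he.sigmaClosed_le_iff hf h0 hk ho).2 (hku.trans h)

/-- A right adjoint is unique and given by the supremum formula, so it is enough to exhibit some
right adjoint in whatever form is convenient. -/
theorem _root_.GaloisConnection.rightAdj {d g : C → C} (h : GaloisConnection d g) :
    GaloisConnection d (rightAdj d) := by
  have : AL.rightAdj d = g := funext fun v =>
    le_antisymm (sSup_le fun u hu => h.le_u hu) (le_sSup (h.l_u_le v))
  rwa [this]

/-- The `σ`-extension of a normal join-preserving operator has a right adjoint. -/
theorem IsCanonicalExtension.gc_sigmaExt (he : IsCanonicalExtension e) {f : L → L}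
    (hf : ∀ x y, f (x ⊔ y) = f x ⊔ f y) (h0 : f ⊥ = ⊥) :
    GaloisConnection (sigmaExt e f) (rightAdj (sigmaExt e f)) := by
  refine GaloisConnection.rightAdj
    -- On open `o` the adjoint is dictated by `sigmaExt_le_iff`; a general `v` is the meet of the
    -- open elements above it, and a right adjoint preserves meets.
    (g := fun v => sInf {x | ∃ o, IsOpenElt e o ∧ v ≤ o ∧ x = sSup (e '' {a | e (f a) ≤ o})}) ?_
  intro u v
  constructor
  · intro h
    apply le_sInf
    rintro _ ⟨o, ho, hvo, rfl⟩
    exact (he.sigmaExt_le_iff hf h0 ho).1 (h.trans hvo)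
  · intro h
    refine he.le_of_open fun o ho hvo => (he.sigmaExt_le_iff hf h0 ho).2 (h.trans ?_)
    exact sInf_le ⟨o, ho, hvo, rfl⟩

/-- Over the order duals, `piExt` is by definition `sigmaExt` and `leftAdj` is `rightAdj`, so the
previous result applies verbatim. -/
theorem IsCanonicalExtension.gc_piExt (he : IsCanonicalExtension e) {f : L → L}
    (hf : ∀ x y, f (x ⊓ y) = f x ⊓ f y) (h1 : f ⊤ = ⊤) :
    GaloisConnection (leftAdj (piExt e f)) (piExt e f) := fun u v =>
  (he.dual.gc_sigmaExt (f := f) hf h1 v u).symm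

theorem IsCanonicalExtension.piExt_map (he : IsCanonicalExtension e) {f : L → L}
    (hf : Monotone f) (a : L) : piExt e f (e a) = e (f a) :=
  he.dual.sigmaExt_map (f := f) (fun _ _ h => hf h) a

/-- The left adjoint of the `π`-extension maps closed elements to closed elements. -/
theorem IsCanonicalExtension.leftAdj_piExt_eq (he : IsCanonicalExtension e) {f : L → L}
    (hf : ∀ x y, f (x ⊓ y) = f x ⊓ f y) (h1 : f ⊤ = ⊤) {k : C} (hk : IsClosedElt e k) :
    leftAdj (piExt e f) k = sInf (e '' {a | k ≤ e (f a)}) :=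
  -- Both sides have the same upper bounds: `k` is open in the dual, where `sigmaExt_le_iff`
  -- characterises `k ≤ □^π v`.
  eq_of_forall_ge_iff fun v => (he.gc_piExt hf h1 k v).trans
    (he.dual.sigmaExt_le_iff (f := f) (u := v) (o := k) hf h1 hk)

end CanonicalExtension

/-! ### Canonicity of the five principles -/

section Canonicity

variable {L C : Type*} [Lattice L] [BoundedOrder L] [CompleteLattice C]
  {e : BoundedLatticeHom L C} {𝔸 : ModalOps L}

theorem ModalOps.dia_mono (𝔸 : ModalOps L) : Monotone 𝔸.dia := monotone_of_map_sup 𝔸.dia_sup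

theorem ModalOps.box_mono (𝔸 : ModalOps L) : Monotone 𝔸.box :=
  fun x y h => by rw [← inf_eq_left.2 h, 𝔸.box_inf]; exact inf_le_right

theorem le_sigmaExt_of_forall {f : L → L} {k w : C} (hk : IsClosedElt e k)
    (h : ∀ a, k ≤ e a → w ≤ e (f a)) : w ≤ sigmaExt e f k := by
  rw [sigmaExt_of_isClosedElt f hk]
  apply le_sInf
  rintro _ ⟨a, ha, rfl⟩
  exact h a ha

/-- All five modal principles are canonical. -/
theorem ModalOps.Validates.canonical (he : IsCanonicalExtension e) {x : Principle}
    (hx : 𝔸.Validates x) (v : Unit → C) :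
    (x.lhs (Fml.var ())).eval (sigmaExt e 𝔸.dia) (piExt e 𝔸.box) v ≤
      (x.rhs (Fml.var ())).eval (sigmaExt e 𝔸.dia) (piExt e 𝔸.box) v := by
  have gd := he.gc_sigmaExt 𝔸.dia_sup 𝔸.dia_bot
  have gb := he.gc_piExt 𝔸.box_inf 𝔸.box_top
  have ed := he.sigmaExt_map 𝔸.dia_mono
  have eb := he.piExt_map 𝔸.box_mono
  -- Closedness of `◆k` lets `◇^σ` at `◆k` be computed from elements of `L`, which is what (D) and
  -- (C) need.
  have hbdia : ∀ k, IsClosedElt e k → IsClosedElt e (leftAdj (piExt e 𝔸.box) k) := fun k hk =>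
    ⟨_, he.leftAdj_piExt_eq 𝔸.box_inf 𝔸.box_top hk⟩
  have hbox : ∀ k a, leftAdj (piExt e 𝔸.box) k ≤ e a → k ≤ e (𝔸.box a) := fun k a h =>
    (gb.le_u h).trans (eb a).le
  have hval : ∀ a, e ((x.lhs (Fml.var ())).eval 𝔸.dia 𝔸.box fun _ => a) ≤
      e ((x.rhs (Fml.var ())).eval 𝔸.dia 𝔸.box fun _ => a) := fun a =>
    he.le_iff_le.2 (hx fun _ => a)
  have hv : v = fun _ => v () := rfl
  rw [hv]
  generalize v () = u
  cases x <;> simp only [Principle.lhs, Principle.rhs, Fml.eval] at hval ⊢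
  case T =>
    refine he.le_of_open fun o ho huo => (gb.monotone_u huo).trans ?_
    refine le_trans (sInf_le ⟨o, ho, le_rfl, rfl⟩) (sSup_le ?_)
    rintro _ ⟨a, ha, rfl⟩
    exact (hval a).trans ha
  case four =>
    -- Moving both diamonds to the right isolates `u` on the left, where it can be replaced by a
    -- closed `k`; the diamonds are then moved back.
    rw [gd.le_iff_le, gd.le_iff_le]
    refine he.le_of_closed fun k hk hku => ?_
    rw [← gd.le_iff_le, ← gd.le_iff_le]
    refine le_trans (le_sigmaExt_of_forall hk fun a ha => ?_) (gd.monotone_l hku)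
    calc _ ≤ sigmaExt e 𝔸.dia (sigmaExt e 𝔸.dia (e a)) := gd.monotone_l (gd.monotone_l ha)
      _ = e (𝔸.dia (𝔸.dia a)) := by rw [ed, ed]
      _ ≤ _ := hval a
  case B =>
    refine he.le_of_closed fun k hk hku => ?_
    refine le_trans ?_ (gb.monotone_u (gd.monotone_l hku))
    rw [← gb.le_iff_le]
    refine le_sigmaExt_of_forall hk fun a ha => ?_
    rw [gb.le_iff_le, eb]
    exact ha.trans (hval a)
  case D =>
    refine he.le_of_closed fun k hk hku => ?_
    -- From `k ≤ □u` follows `◆k ≤ u`, so the smallest possible `u`, namely `◆k`, is the only case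
    -- to check.
    refine le_trans ?_ (gd.monotone_l (gb.l_le hku))
    exact le_sigmaExt_of_forall (hbdia k hk) fun a ha => (hbox k a ha).trans (hval a)
  case C =>
    rw [gd.le_iff_le]
    refine he.le_of_closed fun k hk hku => ?_
    rw [← gd.le_iff_le]
    refine le_trans ?_ (gb.monotone_u (gd.monotone_l (gb.l_le hku)))
    rw [← gb.le_iff_le]
    refine le_sigmaExt_of_forall (hbdia k hk) fun a ha => ?_
    rw [gb.le_iff_le, eb]
    calc _ ≤ sigmaExt e 𝔸.dia (e (𝔸.box a)) := gd.monotone_l (hbox k a ha)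
      _ = e (𝔸.dia (𝔸.box a)) := ed _
      _ ≤ _ := hval a

end Canonicity

/-! ### Reassigning a nominal or a conominal -/

section Assignments

variable {P N M : Type*} {C : Type*} {𝒥 ℳ : Set C}

/-- Well-formedness is the source of freshness inside terms: the switch rules only ask that `j` be
absent from the context. Since `j ≤ m` also arises from `IsStructure.tmConom`, a second case occurs,
in which the term is a conominal. -/
theorem not_hasNom_of_isStructure {j : N} {T : Tm N M}
    (h : IsStructure (nomTm j T : Ineq P N M)) : ¬ T.HasNom j := by
  generalize hs : (nomTm j T : Ineq P N M) = s at h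
  cases h <;> simp [AL.nomTm, AL.nomFml, AL.fmlConom, AL.tmConom] at hs
  · obtain ⟨rfl, rfl⟩ := hs
    assumption
  · obtain ⟨rfl, rfl⟩ := hs
    simp [Tm.HasNom]

theorem not_hasConom_of_isStructure {m : M} {T : Tm N M}
    (h : IsStructure (tmConom T m : Ineq P N M)) : ¬ T.HasConom m := by
  generalize hs : (tmConom T m : Ineq P N M) = s at h
  cases h <;> simp [AL.nomTm, AL.nomFml, AL.fmlConom, AL.tmConom] at hs
  · obtain ⟨rfl, rfl⟩ := hs
    simp [Tm.HasConom]
  · obtain ⟨rfl, rfl⟩ := hs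
    assumption

open Classical in
/-- Reassign the nominal `j`. -/
noncomputable def Assignment.setNom (v : Assignment P N M 𝒥 ℳ) (j : N) (x : 𝒥) :
    Assignment P N M 𝒥 ℳ := { v with nom := Function.update v.nom j x }

open Classical in
/-- Reassign the conominal `m`. -/
noncomputable def Assignment.setConom (v : Assignment P N M 𝒥 ℳ) (m : M) (y : ℳ) :
    Assignment P N M 𝒥 ℳ := { v with conom := Function.update v.conom m y }

variable {v : Assignment P N M 𝒥 ℳ}

@[simp] theorem Assignment.setNom_prop (j : N) (x : 𝒥) : (v.setNom j x).prop = v.prop := rfl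
@[simp] theorem Assignment.setNom_conom (j : N) (x : 𝒥) : (v.setNom j x).conom = v.conom := rfl
@[simp] theorem Assignment.setNom_nom_self (j : N) (x : 𝒥) : (v.setNom j x).nom j = x := by
  simp [setNom]
theorem Assignment.setNom_nom_of_ne {i j : N} (h : i ≠ j) (x : 𝒥) :
    (v.setNom j x).nom i = v.nom i := by
  simp [setNom, h]
@[simp] theorem Assignment.setConom_prop (m : M) (y : ℳ) : (v.setConom m y).prop = v.prop := rfl
@[simp] theorem Assignment.setConom_nom (m : M) (y : ℳ) : (v.setConom m y).nom = v.nom := rfl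
@[simp] theorem Assignment.setConom_conom_self (m : M) (y : ℳ) :
    (v.setConom m y).conom m = y := by
  simp [setConom]
theorem Assignment.setConom_conom_of_ne {n m : M} (h : n ≠ m) (y : ℳ) :
    (v.setConom m y).conom n = v.conom n := by
  simp [setConom, h]

end Assignments

/-! ### Refutations and the rule-by-rule check -/

section Soundness

variable {P N M : Type*} {C : Type*} [CompleteLattice C] {𝒥 ℳ : Set C} {d b : C → C}

theorem JoinGenerates.le_of_forall (h𝒥 : JoinGenerates 𝒥) {u w : C}
    (h : ∀ x : 𝒥, (x : C) ≤ u → (x : C) ≤ w) : u ≤ w := by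
  obtain ⟨S, hS, rfl⟩ := h𝒥 u
  exact sSup_le fun x hx => h ⟨x, hS hx⟩ (le_sSup hx)

theorem MeetGenerates.le_of_forall (hℳ : MeetGenerates ℳ) {u w : C}
    (h : ∀ y : ℳ, w ≤ (y : C) → u ≤ (y : C)) : u ≤ w := by
  obtain ⟨S, hS, rfl⟩ := hℳ w
  exact le_sInf fun y hy => h ⟨y, hS hy⟩ (sInf_le hy)

variable {v : Assignment P N M 𝒥 ℳ}

theorem Tm.eval_setNom {j : N} {T : Tm N M} (h : ¬ T.HasNom j) (x : 𝒥) :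
    T.eval d b (v.setNom j x) = T.eval d b v := by
  cases T <;> simp_all [Tm.eval, Tm.HasNom, Assignment.setNom_nom_of_ne]

theorem Tm.eval_setConom {m : M} {T : Tm N M} (h : ¬ T.HasConom m) (y : ℳ) :
    T.eval d b (v.setConom m y) = T.eval d b v := by
  cases T <;> simp_all [Tm.eval, Tm.HasConom, Assignment.setConom_conom_of_ne]

theorem Expr.eval_setNom {j : N} {E : Expr P N M} (h : ¬ E.HasNom j) (x : 𝒥) :
    E.eval d b (v.setNom j x) = E.eval d b v := by
  cases E
  · rfl
  · exact Tm.eval_setNom h x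

theorem Expr.eval_setConom {m : M} {E : Expr P N M} (h : ¬ E.HasConom m) (y : ℳ) :
    E.eval d b (v.setConom m y) = E.eval d b v := by
  cases E
  · rfl
  · exact Tm.eval_setConom h y

theorem Ineq.holds_setNom {j : N} {s : Ineq P N M} (h : ¬ s.HasNom j) (x : 𝒥) :
    s.Holds d b (v.setNom j x) ↔ s.Holds d b v := by
  simp only [Ineq.HasNom, not_or] at h
  simp only [Ineq.Holds, Expr.eval_setNom h.1, Expr.eval_setNom h.2]

theorem Ineq.holds_setConom {m : M} {s : Ineq P N M} (h : ¬ s.HasConom m) (y : ℳ) :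
    s.Holds d b (v.setConom m y) ↔ s.Holds d b v := by
  simp only [Ineq.HasConom, not_or] at h
  simp only [Ineq.Holds, Expr.eval_setConom h.1, Expr.eval_setConom h.2]

@[simp] theorem holds_nomFml {j : N} {A : Fml P} :
    (nomFml j A : Ineq P N M).Holds d b v ↔ (v.nom j : C) ≤ A.eval d b v.prop := Iff.rfl
@[simp] theorem holds_fmlConom {m : M} {A : Fml P} :
    (fmlConom A m : Ineq P N M).Holds d b v ↔ A.eval d b v.prop ≤ (v.conom m : C) := Iff.rfl
@[simp] theorem holds_nomTm {j : N} {T : Tm N M} :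
    (nomTm j T : Ineq P N M).Holds d b v ↔ (v.nom j : C) ≤ T.eval d b v := Iff.rfl
@[simp] theorem holds_tmConom {m : M} {T : Tm N M} :
    (tmConom T m : Ineq P N M).Holds d b v ↔ T.eval d b v ≤ (v.conom m : C) := Iff.rfl

theorem holds_nom_left {j : N} {X : Expr P N M} :
    Ineq.Holds d b v ⟨.tm (.nom j), X⟩ ↔ (v.nom j : C) ≤ X.eval d b v := Iff.rfl
theorem holds_conom_right {m : M} {X : Expr P N M} :
    Ineq.Holds d b v ⟨X, .tm (.conom m)⟩ ↔ X.eval d b v ≤ (v.conom m : C) := Iff.rfl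

/-- `v` refutes the sequent `Γ ⊢ Δ`. -/
def Refutes (d b : C → C) (v : Assignment P N M 𝒥 ℳ) (Γ Δ : Multiset (Ineq P N M)) : Prop :=
  (∀ a ∈ Γ, a.Holds d b v) ∧ ∀ a ∈ Δ, ¬ a.Holds d b v

/-- Refutations treat the two sides of a sequent alike and decompose as conjunctions over its
members, so contexts are carried along unchanged. -/
theorem Sequent.valid_iff {Γ Δ : Multiset (Ineq P N M)} :
    (Sequent.mk Γ Δ).Valid d b 𝒥 ℳ ↔ ∀ v : Assignment P N M 𝒥 ℳ, ¬ Refutes d b v Γ Δ := by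
  simp only [Sequent.Valid, Refutes, not_and, not_forall, not_not, exists_prop]

@[simp] theorem refutes_cons_left {a : Ineq P N M} {Γ Δ : Multiset (Ineq P N M)} :
    Refutes d b v (a ::ₘ Γ) Δ ↔ a.Holds d b v ∧ Refutes d b v Γ Δ := by
  simp [Refutes, and_assoc]

@[simp] theorem refutes_cons_right {a : Ineq P N M} {Γ Δ : Multiset (Ineq P N M)} :
    Refutes d b v Γ (a ::ₘ Δ) ↔ ¬ a.Holds d b v ∧ Refutes d b v Γ Δ := by
  simp [Refutes, and_left_comm]

theorem refutes_add {Γ Γ' Δ Δ' : Multiset (Ineq P N M)} :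
    Refutes d b v (Γ + Γ') (Δ + Δ') ↔ Refutes d b v Γ Δ ∧ Refutes d b v Γ' Δ' := by
  simp only [Refutes, Multiset.mem_add, or_imp, forall_and]
  tauto

theorem Refutes.setNom {j : N} {Γ Δ : Multiset (Ineq P N M)} (h : Refutes d b v Γ Δ)
    (hΓ : FreshNom j Γ) (hΔ : FreshNom j Δ) (x : 𝒥) : Refutes d b (v.setNom j x) Γ Δ :=
  ⟨fun a ha => (Ineq.holds_setNom (hΓ a ha) x).2 (h.1 a ha),
    fun a ha => (Ineq.holds_setNom (hΔ a ha) x).not.2 (h.2 a ha)⟩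

theorem Refutes.setConom {m : M} {Γ Δ : Multiset (Ineq P N M)} (h : Refutes d b v Γ Δ)
    (hΓ : FreshConom m Γ) (hΔ : FreshConom m Δ) (y : ℳ) : Refutes d b (v.setConom m y) Γ Δ :=
  ⟨fun a ha => (Ineq.holds_setConom (hΓ a ha) y).2 (h.1 a ha),
    fun a ha => (Ineq.holds_setConom (hΔ a ha) y).not.2 (h.2 a ha)⟩

/-- All inferences are sound in a complete lattice with a pair of normal operators that have
adjoints and satisfy the modal principles. -/
theorem Inference.sound (gd : GaloisConnection d (rightAdj d))
    (gb : GaloisConnection (leftAdj b) b) (h𝒥 : JoinGenerates 𝒥) (hℳ : MeetGenerates ℳ)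
    {Sig : Set Principle}
    (hSig : ∀ x ∈ Sig, ∀ v : Unit → C,
      (x.lhs (Fml.var ())).eval d b v ≤ (x.rhs (Fml.var ())).eval d b v)
    {ps : List (Sequent P N M)} {c : Sequent P N M} (hrule : Inference Sig ps c)
    (hps : ∀ s ∈ ps, s.Valid d b 𝒥 ℳ) : c.Valid d b 𝒥 ℳ := by
  obtain ⟨hr, hwf, hwfc⟩ := hrule
  have hT : Principle.T ∈ Sig → ∀ u, b u ≤ u := fun h u => hSig _ h fun _ => u
  have h4 : Principle.four ∈ Sig → ∀ u, d (d u) ≤ d u := fun h u => hSig _ h fun _ => u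
  have hB : Principle.B ∈ Sig → ∀ u, u ≤ b (d u) := fun h u => hSig _ h fun _ => u
  have hD : Principle.D ∈ Sig → ∀ u, b u ≤ d u := fun h u => hSig _ h fun _ => u
  have hC : Principle.C ∈ Sig → ∀ u, d (b u) ≤ b (d u) := fun h u => hSig _ h fun _ => u
  clear hSig
  have md := gd.monotone_l
  have mb := gb.monotone_u
  -- The common premise of (D) and (C) says `◇◆j ≤ m` once the fresh `k` ranges over all generators
  -- below `◆j`; well-formedness guarantees `k ≠ j`.
  have hbdia : ∀ {v : Assignment P N M 𝒥 ℳ} {Γ Δ : Multiset (Ineq P N M)} {j k : N} {m : M},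
      (Sequent.mk (nomTm k (.bdia j) ::ₘ Γ) (tmConom (.dia k) m ::ₘ Δ)).WellFormed →
      (∀ v : Assignment P N M 𝒥 ℳ,
        ¬ Refutes d b v (nomTm k (.bdia j) ::ₘ Γ) (tmConom (.dia k) m ::ₘ Δ)) →
      FreshNom k Γ → FreshNom k Δ → Refutes d b v Γ Δ →
      d (leftAdj b (v.nom j)) ≤ (v.conom m : C) := by
    intro v Γ Δ j k m hwf hps hΓ hΔ hv
    have hT := not_hasNom_of_isStructure (hwf.1 _ (Multiset.mem_cons_self _ _))
    rw [gd.le_iff_le]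
    refine h𝒥.le_of_forall fun x hx => ?_
    rw [← gd.le_iff_le]
    by_contra hn
    refine hps (v.setNom k x) ?_
    simp only [refutes_cons_left, refutes_cons_right, holds_nomTm, holds_tmConom,
      Tm.eval_setNom hT, Assignment.setNom_nom_self, Assignment.setNom_conom]
    exact ⟨by simpa [Tm.eval] using hn, hx, hv.setNom hΓ hΔ x⟩
  -- Wherever the context is refuted, the premise with `j` varying over `𝒥` amounts to `X ≤ Y`,
  -- which transports upper bounds from `Y` to `X`. `swM` is the dual.
  have swJ : ∀ {Γ Δ : Multiset (Ineq P N M)} {j : N} {X Y : Expr P N M} {m : M},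
      FreshNom j Γ → FreshNom j Δ → ¬ X.HasNom j → ¬ Y.HasNom j →
      (∀ v : Assignment P N M 𝒥 ℳ,
        ¬ Refutes d b v (⟨.tm (.nom j), X⟩ ::ₘ Γ) (⟨.tm (.nom j), Y⟩ ::ₘ Δ)) →
      ∀ v : Assignment P N M 𝒥 ℳ,
        ¬ Refutes d b v (⟨Y, .tm (.conom m)⟩ ::ₘ Γ) (⟨X, .tm (.conom m)⟩ ::ₘ Δ) := by
    intro Γ Δ j X Y m hΓ hΔ hX hY hps v hv
    simp only [refutes_cons_left, refutes_cons_right] at hv hps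
    refine hv.1 (le_trans (h𝒥.le_of_forall fun x hx => ?_) hv.2.1)
    by_contra hn
    refine hps (v.setNom j x) ⟨?_, ?_, hv.2.2.setNom hΓ hΔ x⟩
    · simpa only [holds_nom_left, Expr.eval_setNom hY, Assignment.setNom_nom_self] using hn
    · simpa only [holds_nom_left, Expr.eval_setNom hX, Assignment.setNom_nom_self] using hx
  have swM : ∀ {Γ Δ : Multiset (Ineq P N M)} {j : N} {X Y : Expr P N M} {m : M},
      FreshConom m Γ → FreshConom m Δ → ¬ X.HasConom m → ¬ Y.HasConom m →
      (∀ v : Assignment P N M 𝒥 ℳ,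
        ¬ Refutes d b v (⟨X, .tm (.conom m)⟩ ::ₘ Γ) (⟨Y, .tm (.conom m)⟩ ::ₘ Δ)) →
      ∀ v : Assignment P N M 𝒥 ℳ,
        ¬ Refutes d b v (⟨.tm (.nom j), Y⟩ ::ₘ Γ) (⟨.tm (.nom j), X⟩ ::ₘ Δ) := by
    intro Γ Δ j X Y m hΓ hΔ hX hY hps v hv
    simp only [refutes_cons_left, refutes_cons_right] at hv hps
    refine hv.1 (le_trans hv.2.1 (hℳ.le_of_forall fun y hy => ?_))
    by_contra hn
    refine hps (v.setConom m y) ⟨?_, ?_, hv.2.2.setConom hΓ hΔ y⟩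
    · simpa only [holds_conom_right, Expr.eval_setConom hY, Assignment.setConom_conom_self] using hn
    · simpa only [holds_conom_right, Expr.eval_setConom hX, Assignment.setConom_conom_self] using hy
  cases hr <;>
    simp only [List.mem_cons, List.not_mem_nil, or_false, forall_eq_or_imp, forall_eq,
      Sequent.valid_iff] at hps hwf ⊢
  case id_nom | id_conom | id_bot | id_top =>
    rintro v ⟨h, h'⟩
    exact h' _ (Multiset.mem_singleton_self _) (h _ (Multiset.mem_singleton_self _))
  case bot_nom j A hA =>
    rintro v ⟨h, h'⟩
    have hj : (v.nom j : C) ≤ ⊥ := h _ (Multiset.mem_singleton_self _)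
    exact h' _ (Multiset.mem_singleton_self _) (hj.trans bot_le)
  case bot_conom =>
    rintro v ⟨h, h'⟩
    exact h' _ (Multiset.mem_singleton_self _) bot_le
  case top_conom =>
    rintro v ⟨h, h'⟩
    exact h' _ (Multiset.mem_singleton_self _)
      (le_trans le_top (h _ (Multiset.mem_singleton_self _)))
  case top_nom =>
    rintro v ⟨h, h'⟩
    exact h' _ (Multiset.mem_singleton_self _) le_top
  case cut_nom | cut_conom =>
    intro v hv
    rw [refutes_add] at hv
    have h1 := hps.1 v
    have h2 := hps.2 v
    rw [refutes_cons_right] at h1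
    rw [refutes_cons_left] at h2
    tauto
  case sw_m Γ Δ j m A hΓ hΔ =>
    intro v hv
    rw [refutes_cons_right] at hv
    refine hv.1 (h𝒥.le_of_forall fun x hx => ?_)
    by_contra hn
    refine hps (v.setNom j x) ?_
    simpa [Tm.eval] using ⟨hn, hx, hv.2.setNom hΓ hΔ x⟩
  case sw_j Γ Δ j m A hΓ hΔ =>
    intro v hv
    rw [refutes_cons_right] at hv
    refine hv.1 (hℳ.le_of_forall fun y hy => ?_)
    by_contra hn
    refine hps (v.setConom m y) ?_
    simpa [Tm.eval] using ⟨hn, hy, hv.2.setConom hΓ hΔ y⟩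
  case sw_mm Γ Δ j m A B hjΓ hjΔ hmΓ hmΔ =>
    exact swJ hjΓ hjΔ (X := .fml A) (Y := .fml B) id id hps
  case sw_jj Γ Δ j m A B hjΓ hjΔ hmΓ hmΔ =>
    exact swM hmΓ hmΔ (X := .fml A) (Y := .fml B) id id hps
  case sw_mT Γ Δ j m A T hjΓ hjΔ hmΓ hmΔ =>
    exact swJ hjΓ hjΔ (X := .tm T) (Y := .fml A)
      (not_hasNom_of_isStructure (hwf.1 _ (Multiset.mem_cons_self _ _))) id hps
  case sw_jT Γ Δ j m A T hjΓ hjΔ hmΓ hmΔ =>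
    exact swM hmΓ hmΔ (X := .tm T) (Y := .fml A)
      (not_hasConom_of_isStructure (hwf.1 _ (Multiset.mem_cons_self _ _))) id hps
  case sw_Tm Γ Δ j m A T hjΓ hjΔ hmΓ hmΔ =>
    exact swJ hjΓ hjΔ (X := .fml A) (Y := .tm T) id
      (not_hasNom_of_isStructure (hwf.2 _ (Multiset.mem_cons_self _ _))) hps
  case sw_Tj Γ Δ j m A T hjΓ hjΔ hmΓ hmΔ =>
    exact swM hmΓ hmΔ (X := .fml A) (Y := .tm T) id
      (not_hasConom_of_isStructure (hwf.2 _ (Multiset.mem_cons_self _ _))) hps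
  case sw_TTm Γ Δ j m T T' hjΓ hjΔ hmΓ hmΔ =>
    exact swJ hjΓ hjΔ (X := .tm T') (Y := .tm T)
      (not_hasNom_of_isStructure (hwf.1 _ (Multiset.mem_cons_self _ _)))
      (not_hasNom_of_isStructure (hwf.2 _ (Multiset.mem_cons_self _ _))) hps
  case sw_jTT Γ Δ j m T T' hjΓ hjΔ hmΓ hmΔ =>
    exact swM hmΓ hmΔ (X := .tm T') (Y := .tm T)
      (not_hasConom_of_isStructure (hwf.1 _ (Multiset.mem_cons_self _ _)))
      (not_hasConom_of_isStructure (hwf.2 _ (Multiset.mem_cons_self _ _))) hps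
  case box_S Γ Δ j m A hΓ hΔ =>
    intro v hv
    rw [refutes_cons_right] at hv
    -- The goal `j ≤ □A` becomes `◆j ≤ A`, which can be tested against `ℳ`; dually, `dia_P` tests `A
    -- ≤ ■m` against `𝒥`.
    refine hv.1 ((gb.le_iff_le).1 (hℳ.le_of_forall fun y hy => ?_))
    rw [gb.le_iff_le]
    by_contra hn
    refine hps (v.setConom m y) ?_
    simpa [Tm.eval] using ⟨hn, hy, hv.2.setConom hΓ hΔ y⟩
  case dia_P Γ Δ j m A hΓ hΔ =>
    intro v hv
    rw [refutes_cons_right] at hv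
    refine hv.1 ((gd.le_iff_le).2 (h𝒥.le_of_forall fun x hx => ?_))
    rw [← gd.le_iff_le]
    by_contra hn
    refine hps (v.setNom j x) ?_
    simpa [Tm.eval] using ⟨hn, hx, hv.2.setNom hΓ hΔ x⟩
  case rule_D hSig Γ Δ j k m hΓ hΔ =>
    intro v hv
    rw [refutes_cons_right] at hv
    refine hv.1 ?_
    -- `j ≤ □◆j ≤ ◇◆j ≤ m`.
    exact ((gb.le_u_l _).trans (hD hSig _)).trans (hbdia hwf hps hΓ hΔ hv.2)
  case rule_C hSig Γ Δ j k h m hΓ hΔ =>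
    intro v hv
    rw [refutes_cons_left, refutes_cons_right] at hv
    refine hv.2.1 ((gb.le_iff_le).2 (le_trans hv.1 ?_))
    -- `◇j ≤ ◇□◆j ≤ □◇◆j ≤ □m`.
    exact ((md (gb.le_u_l _)).trans (hC hSig _)).trans (mb (hbdia hwf hps hΓ hΔ hv.2.2))
  all_goals
    intro v hv
    simp only [refutes_cons_left, refutes_cons_right, holds_nomFml, holds_fmlConom, holds_nomTm,
      holds_tmConom, Tm.eval, Fml.eval] at hv hps
  case adj_dia => exact hps v ⟨fun h => hv.1 (gd.le_u h), hv.2⟩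
  case adj_dia_inv => exact hps v ⟨fun h => hv.1 (gd.l_le h), hv.2⟩
  case adj_box => exact hps v ⟨fun h => hv.1 (gb.l_le h), hv.2⟩
  case adj_box_inv => exact hps v ⟨fun h => hv.1 (gb.le_u h), hv.2⟩
  case top_box => exact hps v ⟨fun h => hv.1 (gb.le_u (le_top.trans h)), hv.2.2⟩
  case bot_dia => exact hps v ⟨fun h => hv.1 (gd.l_le (h.trans bot_le)), hv.2.2⟩
  case and_P₁ => exact hps v ⟨hv.1.trans inf_le_left, hv.2⟩
  case and_P₂ => exact hps v ⟨hv.1.trans inf_le_right, hv.2⟩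
  case and_S =>
    exact hps.1 v ⟨fun h1 => hps.2 v ⟨fun h2 => hv.1 (le_inf h1 h2), hv.2⟩, hv.2⟩
  case or_P =>
    exact hps.1 v ⟨fun h1 => hps.2 v ⟨fun h2 => hv.1 (sup_le h1 h2), hv.2⟩, hv.2⟩
  case or_S₁ => exact hps v ⟨le_sup_left.trans hv.1, hv.2⟩
  case or_S₂ => exact hps v ⟨le_sup_right.trans hv.1, hv.2⟩
  case box_P => exact hps v ⟨fun h => hv.1 (hv.2.1.trans (mb h)), hv.2.2⟩
  case dia_S => exact hps v ⟨fun h => hv.1 ((md h).trans hv.2.1), hv.2.2⟩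
  case rule_four hSig _ _ _ _ _ =>
    exact hps v ⟨fun h => hv.1 (((md hv.2.1).trans (h4 hSig _)).trans h), hv.2.2⟩
  case rule_T hSig _ _ _ _ => exact hps v ⟨fun h => hv.1 (h.trans (hT hSig _)), hv.2⟩
  case rule_B hSig _ _ _ _ => exact hps v ⟨fun h => hv.1 ((hB hSig _).trans (mb h)), hv.2⟩

end Soundness

end AL

theorem mainTheorem3 {P N M : Type*} (Sig : Set AL.Principle)
    (premises : List (AL.Sequent P N M)) (conclusion : AL.Sequent P N M)
    (hrule : AL.Inference Sig premises conclusion)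
    {L : Type*} [Lattice L] [BoundedOrder L] (𝔸 : AL.ModalOps L)
    (h𝔸 : ∀ x ∈ Sig, 𝔸.Validates x)
    {C : Type*} [CompleteLattice C] (e : BoundedLatticeHom L C)
    (he : AL.IsCanonicalExtension e)
    (𝒥 ℳ : Set C) (h𝒥 : AL.JoinGenerates 𝒥) (hℳ : AL.MeetGenerates ℳ)
    (hpremises : ∀ s ∈ premises, s.ValidInExtension 𝔸 e 𝒥 ℳ) :
    conclusion.ValidInExtension 𝔸 e 𝒥 ℳ :=
  hrule.sound (he.gc_sigmaExt 𝔸.dia_sup 𝔸.dia_bot) (he.gc_piExt 𝔸.box_inf 𝔸.box_top) h𝒥 hℳ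
    (fun x hx => (h𝔸 x hx).canonical he) hpremises
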